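/- Let $\Sigma$ be a finite set of symbols. For a finite collection $\mathcal F$ of words, let $\Sigma_{\mathcal F}$ be the one-sided subshift of finite type (SFT) of all sequences in $\Sigma^{\mathbb N}$ in which no word of $\mathcal F$ appears. The language $\mathcal L(S)$ of a subshift $S$ is the set of all words of length at least $1$ that appear in some element of $S$, and $S$ is irreducible if for all $u,v\in\mathcal L(S)$ there is a (possibly empty) word $w$ with $uwv\in\mathcal L(S)$. A collection of words is reduced if no word in it is a subword (contiguous block) of another one. Let $\mathcal F$ be a finite reduced collection of words of length at least $2$ such that every symbol of $\Sigma$ is in $\mathcal L:=\mathcal L(\Sigma_{\mathcal F})$ and $\Sigma_{\mathcal F}$ is irreducible; let $\mathcal L_n$ be the set of words of length $n$ in $\mathcal L$. Let $\mathcal R=\{r_1,\dots,r_\ell\}\subseteq\mathcal L$ be a finite reduced collection of words with assigned multiplicities $m_i\ge 2$. Let $p$ be the length of the longest word in $\mathcal F\cup\mathcal R$, and assume $p\ge 2$. For a word $w$ put $m(w)=\prod_i m_i^{n(w;r_i)}$ if $w\in\mathcal L$, where $n(w;r_i)$ is the number of occurrences of $r_i$ in $w$, and $m(w)=0$ otherwise.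 The generalized language $\Lambda^p$ is the multiset that contains each word $w\in\mathcal L$ of length at least $p$ exactly $m(w)$ times. For $v=v_1\cdots v_n\in\mathcal L_n$ with $n\ge2$ put $k(v)=m(v)/m(v_2\cdots v_n)$, which is an integer. Let $A$ be the matrix indexed by $\mathcal L_{p-1}$ with $A_{XY}=k(x_1\cdots x_{p-1}y_{p-1})$ if $x_2\cdots x_{p-1}=y_1\cdots y_{p-2}$ and $x_1\cdots x_{p-1}y_{p-1}\in\mathcal L_p$, and $A_{XY}=0$ otherwise. Let $\Sigma_A$ be its edge shift: the set of all one-sided infinite paths of edges in the directed multigraph with vertex set $\mathcal L_{p-1}$ and $A_{XY}$ distinct edges from $X$ to $Y$. Containments are understood up to relabeling symbols. For languages, $\mathcal L_1\subsetneq\mathcal L_2$ means that some injective map of the symbols of $\mathcal L_1$ to the symbols of $\mathcal L_2$ carries $\mathcal L_1$ onto a proper subset of $\mathcal L_2$. For an SFT $S$ over a finite alphabet $B$, $\mathcal L(S)\subseteq\Lambda^p$ means that the symbols of $S$ can be labelled by words, through a map $\pi$ on $B$, such that for each $u=u_1\cdots u_j\in\mathcal L(S)$ the sequence $\pi(u_1),\dots,\pi(u_j)$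 is the sequence of successive subwords of length $p$ of some word of length $j+p-1$ over $\Sigma$, and such that each word $w$ over $\Sigma$ of length at least $p$ is obtained in this way from at most $m(w)$ words $u\in\mathcal L(S)$; the containment is proper, $\mathcal L(S)\subsetneq\Lambda^p$, if $\pi$ can moreover be chosen so that this inequality is strict for some $w$. Let $\mathcal S$ be the collection of all irreducible subshifts of finite type $S$ (over any finite alphabet) with $\mathcal L(S)\subseteq\Lambda^p$. Then there is no $S\in\mathcal S$ such that $$\mathcal L(\Sigma_A)\subsetneq\mathcal L(S)\subsetneq\Lambda^p .$$ -/

import Mathlib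

namespace GenLang

/-- The finite word `u` appears in the one-sided sequence `x`. -/
def Occurs {α : Type*} (u : List α) (x : ℕ → α) : Prop :=
  ∃ i : ℕ, ∀ (j : ℕ) (hj : j < u.length), x (i + j) = u[j]

/-- The one-sided subshift of all sequences in which no word of `F` appears. -/
def shiftOf {α : Type*} (F : Finset (List α)) : Set (ℕ → α) :=
  {x | ∀ u ∈ F, ¬ Occurs u x}

/-- Subshifts of finite type: given by finitely many forbidden words. -/
def IsSFT {α : Type*} (X : Set (ℕ → α)) : Prop :=
  ∃ F : Finset (List α), X = shiftOf F

/-- The language of a set of sequences: all words of length at least one that appear in one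
of its elements. -/
def language {α : Type*} (X : Set (ℕ → α)) : Set (List α) :=
  {u | u ≠ [] ∧ ∃ x ∈ X, Occurs u x}

/-- Irreducibility: any two allowed words `u`, `v` occur, in this order and without overlap, in
one allowed word `u w v`. -/
def IsIrreducibleShift {α : Type*} (X : Set (ℕ → α)) : Prop :=
  ∀ u ∈ language X, ∀ v ∈ language X, ∃ w : List α, u ++ w ++ v ∈ language X

/-- A collection of words is reduced if none of them is a subword (a contiguous block) of
another one. -/
def IsReduced {α : Type*} (F : Finset (List α)) : Prop :=
  ∀ u ∈ F, ∀ v ∈ F, u ≠ v → ¬ u <:+: v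

/-- `n(w; r)`: the number of positions at which the word `r` starts in `w`. -/
noncomputable def occ {α : Type*} (w r : List α) : ℕ :=
  {i : ℕ | i < w.length ∧ r <+: w.drop i}.ncard

open Classical in
/-- The multiplicity `m(w)` of a word, for forbidden words `F` and repeated words `r ∈ R` of
multiplicity `μ r`. -/
noncomputable def mult {α : Type*} (F R : Finset (List α)) (μ : List α → ℕ) (w : List α) : ℕ :=
  if w ∈ language (shiftOf F) then ∏ r ∈ R, μ r ^ occ w r else 0

/-- The length `p` of the longest word in `F ∪ R`. -/
def maxLen {α : Type*} (F R : Finset (List α)) : ℕ :=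
  max (F.sup List.length) (R.sup List.length)

open Classical in
/-- The generalized language of level `p`. It is a multiset of words, given here by the number
of times that it contains each word: `m(w)` if `w` has length at least `p`, and `0` otherwise. -/
noncomputable def genLang {α : Type*} (F R : Finset (List α)) (μ : List α → ℕ) (p : ℕ)
    (w : List α) : ℕ∞ :=
  if p ≤ w.length then (mult F R μ w : ℕ∞) else 0

/-- `k(v) = m(v) / m(v₂ … vₙ)`. The division is exact, see `mult_tail_dvd`. -/
noncomputable def kNum {α : Type*} (F R : Finset (List α)) (μ : List α → ℕ) (v : List α) : ℕ :=
  mult F R μ v / mult F R μ v.tail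

theorem occ_tail_le {α : Type*} (v r : List α) : occ v.tail r ≤ occ v r := by
  unfold occ
  refine Set.ncard_le_ncard_of_injOn (fun i => i + 1) ?_ ?_ ?_
  · rintro i ⟨h1, h2⟩
    refine ⟨?_, ?_⟩
    · simp only [List.length_tail] at h1
      omega
    · simpa [List.drop_tail] using h2
  · intro a _ b _ h
    simpa using h
  · exact (Set.finite_lt_nat v.length).subset fun i hi => hi.1

theorem mult_tail_dvd {α : Type*} (F R : Finset (List α)) (μ : List α → ℕ) (v : List α)
    (hv : v.tail ≠ []) : mult F R μ v.tail ∣ mult F R μ v := by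
  unfold mult
  by_cases h : v ∈ language (shiftOf F)
  · have ht : v.tail ∈ language (shiftOf F) := by
      obtain ⟨_, x, hx, i, hi⟩ := h
      refine ⟨hv, x, hx, i + 1, fun j hj => ?_⟩
      have hj' : j + 1 < v.length := by
        simp only [List.length_tail] at hj
        omega
      have := hi (j + 1) hj'
      simp only [List.getElem_tail]
      rw [← this]
      congr 1
      omega
    rw [if_pos h, if_pos ht]
    exact Finset.prod_dvd_prod_of_dvd _ _ fun r _ => pow_dvd_pow _ (occ_tail_le v r)
  · rw [if_neg h]
    exact dvd_zero _

/-- For words `X`, `Y` of the same length `m ≥ 1`, the word `X * Y` is defined if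
`x₂ … xₘ = y₁ … yₘ₋₁`. -/
def StarDefined {α : Type*} (X Y : List α) : Prop := X.tail = Y.dropLast

/-- `X * Y = x₁ … xₘ yₘ` for words of the same length `m ≥ 1`. -/
def star {α : Type*} (X Y : List α) : List α := X ++ Y.drop (X.length - 1)

/-- The allowed words of length `n`. -/
abbrev AllowedWord {α : Type*} (F : Finset (List α)) (n : ℕ) : Type _ :=
  {X : List α // X ∈ language (shiftOf F) ∧ X.length = n}

open Classical in
/-- The adjacency matrix associated with the collections `F` and `R`, indexed by the allowed
words of length `p - 1`, where `p` is the length of the longest word in `F ∪ R`. -/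
noncomputable def adjMatrix {α : Type*} (F R : Finset (List α)) (μ : List α → ℕ) :
    Matrix (AllowedWord F (maxLen F R - 1)) (AllowedWord F (maxLen F R - 1)) ℕ :=
  fun X Y =>
    if StarDefined X.1 Y.1 ∧ star X.1 Y.1 ∈ language (shiftOf F) then kNum F R μ (star X.1 Y.1)
    else 0

/-- The edges of the multigraph of `A`: there are `A x y` of them from `x` to `y`. -/
structure Edge {V : Type*} (A : Matrix V V ℕ) where
  src : V
  tgt : V
  idx : Fin (A src tgt)

/-- The edge shift of `A`: all infinite paths of edges in the multigraph of `A`. -/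
def edgeShift {V : Type*} (A : Matrix V V ℕ) : Set (ℕ → Edge A) :=
  {e | ∀ i : ℕ, (e i).tgt = (e (i + 1)).src}

/-- `L₁ ⊊ L₂` for languages: `L₁` is properly contained in `L₂` upon relabeling the symbols
of `L₁`. -/
def LangSSubset {β γ : Type*} (L₁ : Set (List β)) (L₂ : Set (List γ)) : Prop :=
  ∃ φ : β ↪ γ, List.map φ '' L₁ ⊂ L₂

/-- The successive subwords of length `p` of the word `w`. -/
def blocks {α : Type*} (p : ℕ) (w : List α) : List (List α) :=
  (List.range (w.length + 1 - p)).map fun i => (w.drop i).take p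

/-- The language `L` is written in `p`-block form by the labels `π`: when each symbol `b` is read
as (a copy of) the word `π b`, each word of `L` is the sequence of `p`-blocks of some word `w`. -/
def IsBlockLabelling {α β : Type*} (p : ℕ) (π : β → List α) (L : Set (List β)) : Prop :=
  ∀ u ∈ L, ∃ w : List α, p ≤ w.length ∧ u.map π = blocks p w

/-- The multiset of words `w` that `L` represents under the labels `π`: the number of words in `L`
that read as the sequence of `p`-blocks of `w`. -/
noncomputable def blockCount {α β : Type*} (p : ℕ) (π : β → List α) (L : Set (List β))
    (w : List α) : ℕ∞ :=
  {u ∈ L | u.map π = blocks p w}.encard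

/-- `L ⊆ Λ` for a language `L` and a multiset `Λ` of words (given by its multiplicities), upon
relabeling the symbols of `L` as (copies of) words of length `p`. -/
def LangSubsetGen {α β : Type*} (p : ℕ) (L : Set (List β)) (Λ : List α → ℕ∞) : Prop :=
  ∃ π : β → List α, IsBlockLabelling p π L ∧ ∀ w, blockCount p π L w ≤ Λ w

/-- `L ⊊ Λ`: proper containment of multisets, upon relabeling as in `LangSubsetGen`. -/
def LangSSubsetGen {α β : Type*} (p : ℕ) (L : Set (List β)) (Λ : List α → ℕ∞) : Prop :=
  ∃ π : β → List α, IsBlockLabelling p π L ∧ (∀ w, blockCount p π L w ≤ Λ w) ∧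
    ∃ w, blockCount p π L w < Λ w

end GenLang

/-! The proof compares growth rates. Let `b n` be the number of words of length `n` in the language
of `S`, and `a n` the same for `Σ_A`.

Containment in `Λ^p` bounds `b j` by the sum of `m(w)` over words `w` of length `j + p - 1`. The
matrix `A` is built so that prepending a letter multiplies both `m(w)` and the number of edge paths
reading `w` by `k` of the first `p` letters. Hence `m(w)` is at most a constant times the number of
paths, and `b j ≤ M * a j` (`mult_le_mul_ncard_edgeWords`, `wordCount_le_of_langSubsetGen`).

On the other hand, a factor-closed proper sublanguage of an irreducible SFT cannot have comparable
growth (`not_wordCount_le_mul`). Joining `u` and `v` from the sublanguage by a bounded bridge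
containing a word outside it nearly marks the place of the join. The roughly `n` possible places
therefore give roughly `n` times too many words (`sum_wordCount_mul_le`). -/

namespace GenLang

/-! ### Gluing and bridging words in an SFT -/

/-- The sequence that starts with the word `a` and goes on with `x`. -/
def prepend {β : Type*} (a : List β) (x : ℕ → β) : ℕ → β :=
  fun n => if h : n < a.length then a[n] else x (n - a.length)

theorem prepend_of_lt {β : Type*} {a : List β} (x : ℕ → β) {n : ℕ} (h : n < a.length) :
    prepend a x n = a[n] := dif_pos h

theorem prepend_of_le {β : Type*} {a : List β} (x : ℕ → β) {n : ℕ} (h : a.length ≤ n) :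
    prepend a x n = x (n - a.length) := dif_neg (by omega)

theorem shift_mem_shiftOf {β : Type*} {F : Finset (List β)} {x : ℕ → β} (hx : x ∈ shiftOf F)
    (i : ℕ) : (fun n => x (i + n)) ∈ shiftOf F := by
  rintro u hu ⟨k, hk⟩
  refine hx u hu ⟨i + k, fun j hj => ?_⟩
  rw [← hk j hj, add_assoc]

theorem mem_language_of_infix {β : Type*} {X : Set (ℕ → β)} {u v : List β}
    (hu : u ∈ language X) (hv : v ≠ []) (h : v <:+: u) : v ∈ language X := by
  obtain ⟨_, x, hx, i, hi⟩ := hu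
  obtain ⟨s, t, rfl⟩ := h
  refine ⟨hv, x, hx, i + s.length, fun j hj => ?_⟩
  have h1 := hi (s.length + j) (by simp; omega)
  rw [add_assoc, h1]
  simp [hj]

/-- Every word of the language of an SFT is the beginning of an allowed sequence. -/
theorem exists_start_of_mem_language {β : Type*} {F : Finset (List β)} {u : List β}
    (hu : u ∈ language (shiftOf F)) :
    ∃ x ∈ shiftOf F, ∀ (j : ℕ) (hj : j < u.length), x j = u[j] := by
  obtain ⟨_, x, hx, i, hi⟩ := hu
  exact ⟨_, shift_mem_shiftOf hx i, hi⟩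

theorem exists_append_mem_language {β : Type*} {F : Finset (List β)} {u : List β}
    (hu : u ∈ language (shiftOf F)) (n : ℕ) :
    ∃ v : List β, v.length = n ∧ u ++ v ∈ language (shiftOf F) := by
  obtain ⟨x, hx, hi⟩ := exists_start_of_mem_language hu
  refine ⟨List.ofFn fun k : Fin n => x (u.length + k), by simp, by simp [hu.1], x, hx, 0, ?_⟩
  intro j hj
  rw [List.getElem_append, zero_add]
  split_ifs with h
  · exact hi j h
  · simp only [List.getElem_ofFn]
    congr 1
    omega

/-- Words of an SFT that overlap in at least `N` symbols can be glued. -/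
theorem append_mem_language {β : Type*} {F : Finset (List β)} {N : ℕ}
    (hN : ∀ f ∈ F, f.length ≤ N) {a u b : List β} (hau : a ++ u ∈ language (shiftOf F))
    (hub : u ++ b ∈ language (shiftOf F)) (h : a = [] ∨ N ≤ u.length) :
    a ++ u ++ b ∈ language (shiftOf F) := by
  rcases h with rfl | h
  · simpa using hub
  obtain ⟨y, hy, hyi⟩ := exists_start_of_mem_language hau
  obtain ⟨x, hx, hxi⟩ := exists_start_of_mem_language hub
  have hne : a ++ u ++ b ≠ [] := fun hc => hau.1 (List.append_eq_nil_iff.1 hc).1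
  have hlow : ∀ j, j < (a ++ u).length → prepend a x j = y j := by
    intro j hj
    rw [hyi j hj]
    by_cases hja : j < a.length
    · rw [prepend_of_lt x hja, List.getElem_append_left hja]
    · have hja' := not_lt.1 hja
      rw [prepend_of_le x hja', List.getElem_append_right hja']
      have hj2 : j - a.length < u.length := by
        simp only [List.length_append] at hj
        omega
      rw [hxi _ (by simp; omega), List.getElem_append_left hj2]
  refine ⟨hne, prepend a x, ?_, 0, ?_⟩
  -- A forbidden word starting inside `a` ends inside `a ++ u`, because `u` has length at least `N`,
  -- and so it occurs in `y`. One starting later occurs in `x`.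
  · rintro f hf ⟨i, hi⟩
    have hfN := hN f hf
    rcases lt_or_ge i a.length with hia | hia
    · refine hy f hf ⟨i, fun j hj => ?_⟩
      rw [← hi j hj, hlow]
      simp only [List.length_append]
      omega
    · refine hx f hf ⟨i - a.length, fun j hj => ?_⟩
      rw [← hi j hj, prepend_of_le x (by omega)]
      congr 1
      omega
  · intro j hj
    rw [zero_add]
    by_cases hja : j < a.length
    · rw [prepend_of_lt x hja]
      simp [hja]
    · have hja' := not_lt.1 hja
      simp only [List.length_append] at hj
      rw [prepend_of_le x hja', hxi _ (by simp; omega)]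
      simp only [List.append_assoc]
      rw [List.getElem_append_right hja']

/-- In an irreducible SFT, any two words can be joined by a word of bounded length that
contains a given word. -/
theorem exists_bounded_bridge {β : Type*} [Finite β] {F : Finset (List β)}
    (hirr : IsIrreducibleShift (shiftOf F)) {z : List β} (hz : z ∈ language (shiftOf F)) :
    ∃ K : ℕ, ∀ u ∈ language (shiftOf F), ∀ v ∈ language (shiftOf F),
      ∃ w : List β, w.length ≤ K ∧ z <:+: w ∧ u ++ w ++ v ∈ language (shiftOf F) := by
  classical
  -- The `+ 1` keeps `N` positive even for empty `F`, so the truncations `u'` and `v'` below are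
  -- nonempty.
  set N := F.sup List.length + 1 with hNdef
  have hN : ∀ f ∈ F, f.length ≤ N := fun f hf =>
    (Finset.le_sup (f := List.length) hf).trans (Nat.le_succ _)
  -- Only the last `N` letters of `u` and the first `N` of `v` affect whether a bridge is allowed.
  -- There are finitely many such pairs, hence a uniform bound `K`.
  have key : ∀ q : {l : List β | l.length ≤ N} × {l : List β | l.length ≤ N}, ∃ w : List β,
      q.1.1 ∈ language (shiftOf F) → q.2.1 ∈ language (shiftOf F) →
        z <:+: w ∧ q.1.1 ++ w ++ q.2.1 ∈ language (shiftOf F) := by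
    rintro ⟨⟨u, _⟩, ⟨v, _⟩⟩
    by_cases hu : u ∈ language (shiftOf F)
    · by_cases hv : v ∈ language (shiftOf F)
      · obtain ⟨w₁, h1⟩ := hirr u hu z hz
        obtain ⟨w₂, h2⟩ := hirr _ h1 v hv
        refine ⟨w₁ ++ z ++ w₂, fun _ _ => ⟨⟨w₁, w₂, rfl⟩, ?_⟩⟩
        simpa using h2
      · exact ⟨[], fun _ h => absurd h hv⟩
    · exact ⟨[], fun h => absurd h hu⟩
  choose g hg using key
  have : Finite {l : List β | l.length ≤ N} := List.finite_length_le β N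
  obtain ⟨K, hK⟩ := (Set.finite_range fun q => (g q).length).bddAbove
  refine ⟨K, fun u hu v hv => ?_⟩
  set a := u.take (u.length - N) with ha
  set u' := u.drop (u.length - N) with hu'
  set v' := v.take N with hv'
  set b := v.drop N with hb
  have hua : a ++ u' = u := List.take_append_drop _ _
  have hvb : v' ++ b = v := List.take_append_drop _ _
  have hul : u'.length = min N u.length := by simp [hu']; omega
  have hvl : v'.length = min N v.length := by simp [hv']
  have hupos : 0 < u.length := List.length_pos_of_ne_nil hu.1
  have hvpos : 0 < v.length := List.length_pos_of_ne_nil hv.1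
  have hu'L : u' ∈ language (shiftOf F) :=
    mem_language_of_infix hu (List.ne_nil_of_length_pos (by omega)) (List.drop_suffix _ _).isInfix
  have hv'L : v' ∈ language (shiftOf F) :=
    mem_language_of_infix hv (List.ne_nil_of_length_pos (by omega)) (List.take_prefix _ _).isInfix
  set q : {l : List β | l.length ≤ N} × {l : List β | l.length ≤ N} :=
    (⟨u', by simp only [Set.mem_ofPred_eq]; omega⟩, ⟨v', by simp only [Set.mem_ofPred_eq]; omega⟩)
  obtain ⟨h1, h2⟩ := hg q hu'L hv'L
  refine ⟨g q, hK ⟨q, rfl⟩, h1, ?_⟩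
  have h3 : a ++ u' ++ (g q ++ v') ∈ language (shiftOf F) := by
    refine append_mem_language hN (by rwa [hua]) (by simpa using h2) ?_
    by_cases hl : N ≤ u.length
    · right; omega
    · left; simp [ha]; omega
  rw [hua, ← List.append_assoc] at h3
  by_cases hl : N ≤ v.length
  · have h4 := append_mem_language hN h3 (by rwa [hvb]) (Or.inr (by omega))
    rwa [List.append_assoc, hvb] at h4
  · have hb0 : b = [] := by simp [hb]; omega
    rw [← hvb, hb0, List.append_nil]
    exact h3

/-! ### Growth of proper sublanguages -/

/-- The number of words of length `n` in `L`. -/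
noncomputable def wordCount {β : Type*} (L : Set (List β)) (n : ℕ) : ℕ :=
  {u ∈ L | u.length = n}.ncard

theorem finite_words {β : Type*} [Finite β] (L : Set (List β)) (n : ℕ) :
    {u ∈ L | u.length = n}.Finite :=
  (List.finite_length_eq β n).subset fun _ h => h.2

/-- Cutting a word after `m` letters is injective. Both lengths must be positive, since languages
here exclude the empty word. -/
theorem wordCount_add_le {β : Type*} [Finite β] (X : Set (ℕ → β)) {m n : ℕ} (hm : 0 < m)
    (hn : 0 < n) :
    wordCount (language X) (m + n) ≤ wordCount (language X) m * wordCount (language X) n := by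
  unfold wordCount
  rw [← Set.ncard_prod]
  refine Set.ncard_le_ncard_of_injOn (fun u => (u.take m, u.drop m)) ?_ ?_
    ((finite_words _ _).prod (finite_words _ _))
  · rintro u ⟨hu, hl⟩
    have h1 : (u.take m).length = m := by simp; omega
    have h2 : (u.drop m).length = n := by simp; omega
    have h3 : u.take m ≠ [] := List.ne_nil_of_length_pos (by omega)
    have h4 : u.drop m ≠ [] := List.ne_nil_of_length_pos (by omega)
    exact ⟨⟨mem_language_of_infix hu h3 (List.take_prefix _ _).isInfix, h1⟩,
      ⟨mem_language_of_infix hu h4 (List.drop_suffix _ _).isInfix, h2⟩⟩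
  · intro u _ v _ h
    simp only [Prod.mk.injEq] at h
    rw [← List.take_append_drop m u, h.1, h.2, List.take_append_drop]

theorem wordCount_pos {β : Type*} [Finite β] {X : Set (ℕ → β)} (hX : X.Nonempty) {n : ℕ}
    (hn : 0 < n) : 0 < wordCount (language X) n := by
  obtain ⟨x, hx⟩ := hX
  refine (Set.ncard_pos (finite_words _ _)).2 ⟨List.ofFn fun k : Fin n => x k, ⟨?_, x, hx, 0, ?_⟩,
    by simp⟩
  · exact List.ne_nil_of_length_pos (by simpa using hn)
  · simp

/-- Joining words of a proper sublanguage by bounded bridges outside of it. -/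
theorem sum_wordCount_mul_le {β : Type*} [Finite β] {F : Finset (List β)}
    (hirr : IsIrreducibleShift (shiftOf F)) {L : Set (List β)}
    (hL : L ⊂ language (shiftOf F))
    (hfac : ∀ u ∈ L, ∀ v, v ≠ [] → v <:+: u → v ∈ L) :
    ∃ K : ℕ, ∀ n, ∑ s ∈ Finset.Ico 1 n, wordCount L s * wordCount L (n - s) ≤
      (K + 1) * (K + 1) * wordCount (language (shiftOf F)) (n + K) := by
  classical
  obtain ⟨hsub, hns⟩ := hL
  obtain ⟨z, hz, hzL⟩ := Set.not_subset.1 hns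
  obtain ⟨K, hK⟩ := exists_bounded_bridge hirr hz
  refine ⟨K, fun n => ?_⟩
  -- The word `u w v` is padded on the right so that the total length does not depend on the length
  -- of the bridge.
  have hex : ∀ q : List β × List β, ∃ x : List β, ∃ w : List β, q.1 ∈ L → q.2 ∈ L →
      w.length ≤ K ∧ z <:+: w ∧ (q.1 ++ w ++ q.2) <+: x ∧ x ∈ language (shiftOf F) ∧
        x.length = q.1.length + q.2.length + K := by
    rintro ⟨u, v⟩
    by_cases hu : u ∈ L
    · by_cases hv : v ∈ L
      · obtain ⟨w, h1, h2, h3⟩ := hK u (hsub hu) v (hsub hv)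
        obtain ⟨t, ht, h4⟩ := exists_append_mem_language h3 (K - w.length)
        refine ⟨_, w, fun _ _ => ⟨h1, h2, ⟨t, rfl⟩, h4, ?_⟩⟩
        simp only [List.length_append, ht]
        omega
      · exact ⟨[], [], fun _ h => absurd h hv⟩
    · exact ⟨[], [], fun h => absurd h hu⟩
  choose x w hxw using hex
  -- the length of the shortest nonempty prefix outside of `L`
  let first : List β → ℕ := fun y => sInf {i | 0 < i ∧ y.take i ∉ L}
  have hfirst : ∀ u ∈ L, ∀ v ∈ L, u.length ≤ first (x (u, v)) ∧
      first (x (u, v)) ≤ u.length + K := by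
    intro u hu v hv
    obtain ⟨h1, h2, ⟨t, ht⟩, -, -⟩ := hxw (u, v) hu hv
    have hupos : 0 < u.length := List.length_pos_of_ne_nil (hsub hu).1
    have hmem : u.length + (w (u, v)).length ∈ {i | 0 < i ∧ (x (u, v)).take i ∉ L} := by
      refine ⟨by omega, fun hc => hzL (hfac _ hc z hz.1 ?_)⟩
      rw [← ht]
      have : ((u, v).1 ++ w (u, v) ++ (u, v).2 ++ t).take (u.length + (w (u, v)).length) =
          u ++ w (u, v) := by
        rw [List.append_assoc, ← List.length_append, List.take_left']
        rfl
      rw [this]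
      exact h2.trans (List.suffix_append _ _).isInfix
    constructor
    · refine le_csInf ⟨_, hmem⟩ fun i hi => ?_
      by_contra hlt
      push Not at hlt
      refine hi.2 (hfac u hu _ ?_ ?_)
      · refine List.ne_nil_of_length_pos ?_
        rw [← ht]
        simp only [List.length_take, List.length_append]
        have := hi.1
        omega
      · rw [← ht, List.append_assoc, List.append_assoc, List.take_append_of_le_length hlt.le]
        exact (List.take_prefix _ _).isInfix
    · exact (Nat.sInf_le hmem).trans (by omega)
  let A : ℕ → Finset (List β) := fun s => (finite_words L s).toFinset
  have hA : ∀ s u, u ∈ A s ↔ u ∈ L ∧ u.length = s := fun s u => by simp [A]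
  have hAc : ∀ s, (A s).card = wordCount L s := fun s =>
    (Set.ncard_eq_toFinset_card _ (finite_words L s)).symm
  have hBc : (finite_words (language (shiftOf F)) (n + K)).toFinset.card =
      wordCount (language (shiftOf F)) (n + K) := (Set.ncard_eq_toFinset_card _ _).symm
  simp only [← hAc, ← hBc, ← Finset.card_product]
  rw [← Finset.card_sigma]
  have hr : (Finset.range (K + 1)).card = K + 1 := Finset.card_range _
  rw [← hr, ← Finset.card_product, ← Finset.card_product]
  -- `first (x q.2)` locates the join up to an error of at most `K`. Recording this error and the
  -- bridge length makes the triple `(s, u, v)` recoverable from the padded word.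
  refine Finset.card_le_card_of_injOn
    (fun q => (((w q.2).length, first (x q.2) - q.1), x q.2)) ?_ ?_
  · rintro ⟨s, u, v⟩ h
    simp only [Finset.coe_sigma, Set.mem_sigma_iff, Finset.mem_coe, Finset.mem_Ico,
      Finset.mem_product, hA] at h
    obtain ⟨⟨hs1, hsn⟩, ⟨hu, hus⟩, hv, hvs⟩ := h
    obtain ⟨h1, -, -, h2, h3⟩ := hxw (u, v) hu hv
    have h4 := hfirst u hu v hv
    simp only [Finset.coe_product, Set.mem_prod, Finset.mem_coe, Finset.mem_range,
      Set.Finite.mem_toFinset, Set.mem_ofPred_eq]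
    dsimp only at h3
    refine ⟨⟨by omega, by omega⟩, h2, by omega⟩
  · rintro ⟨s, u, v⟩ h ⟨s', u', v'⟩ h' heq
    simp only [Finset.coe_sigma, Set.mem_sigma_iff, Finset.mem_coe, Finset.mem_Ico,
      Finset.mem_product, hA] at h h'
    obtain ⟨⟨hs1, hsn⟩, ⟨hu, hus⟩, hv, hvs⟩ := h
    obtain ⟨⟨hs1', hsn'⟩, ⟨hu', hus'⟩, hv', hvs'⟩ := h'
    simp only [Prod.mk.injEq] at heq
    obtain ⟨⟨hw, hf⟩, hx⟩ := heq
    have h4 := hfirst u hu v hv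
    have h4' := hfirst u' hu' v' hv'
    -- The truncated subtraction loses nothing, because `first` is at least `s`.
    have hss : s = s' := by
      rw [hx] at hf h4
      omega
    subst hss
    obtain ⟨-, -, ⟨t, ht⟩, -, -⟩ := hxw (u, v) hu hv
    obtain ⟨-, -, ⟨t', ht'⟩, -, -⟩ := hxw (u', v') hu' hv'
    rw [hx, ← ht'] at ht
    simp only [List.append_assoc] at ht
    obtain ⟨e1, e2⟩ := List.append_inj ht (by omega)
    obtain ⟨-, e3⟩ := List.append_inj e2 hw
    obtain ⟨e4, -⟩ := List.append_inj e3 (by omega)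
    rw [e1, e4]

/-- A proper sublanguage of an irreducible SFT grows strictly more slowly than the SFT. -/
theorem not_wordCount_le_mul {β : Type*} [Finite β] {S : Set (ℕ → β)} (hS : IsSFT S)
    (hirr : IsIrreducibleShift S) {L : Set (List β)} (hL : L ⊂ language S)
    (hfac : ∀ u ∈ L, ∀ v, v ≠ [] → v <:+: u → v ∈ L) (C : ℕ) :
    ¬ ∀ n, 0 < n → wordCount (language S) n ≤ C * wordCount L n := by
  intro hC
  obtain ⟨F, rfl⟩ := hS
  obtain ⟨K, hK⟩ := sum_wordCount_mul_le hirr hL hfac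
  have hne : (shiftOf F).Nonempty := by
    obtain ⟨z, hz, -⟩ := Set.exists_of_ssubset hL
    obtain ⟨_, x, hx, _⟩ := hz
    exact ⟨x, hx⟩
  set b := wordCount (language (shiftOf F)) with hb
  -- `D` collects every constant in the bound `(n - 1) * b n ≤ D * b n`; the choice `n = D + 2`
  -- contradicts it.
  set D := C * C * ((K + 1) * (K + 1)) * (b K + 1) with hD
  set n := D + 2 with hn
  have hbn : 0 < b n := wordCount_pos hne (by omega)
  have h1 : (n - 1) * b n ≤ C * C * ∑ s ∈ Finset.Ico 1 n, wordCount L s * wordCount L (n - s) := by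
    rw [Finset.mul_sum, ← Nat.card_Ico 1 n, ← smul_eq_mul]
    refine Finset.card_nsmul_le_sum _ _ _ fun s hs => ?_
    obtain ⟨hs1, hs2⟩ := Finset.mem_Ico.1 hs
    calc b n = b (s + (n - s)) := by rw [Nat.add_sub_cancel' hs2.le]
      _ ≤ b s * b (n - s) := wordCount_add_le _ (by omega) (by omega)
      _ ≤ (C * wordCount L s) * (C * wordCount L (n - s)) :=
        Nat.mul_le_mul (hC s (by omega)) (hC _ (by omega))
      _ = _ := by ring
  -- The term `b K + 1` covers `K = 0`, where `b 0 = 0` and submultiplicativity is unavailable.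
  have h2 : b (n + K) ≤ b n * (b K + 1) := by
    rcases Nat.eq_zero_or_pos K with h0 | h0
    · subst h0
      exact Nat.le_mul_of_pos_right _ (Nat.succ_pos _)
    · exact (wordCount_add_le _ (by omega) h0).trans (Nat.mul_le_mul_left _ (Nat.le_succ _))
  have h3 : (n - 1) * b n ≤ D * b n :=
    calc (n - 1) * b n ≤ C * C * ((K + 1) * (K + 1) * b (n + K)) :=
          h1.trans (Nat.mul_le_mul_left _ (hK n))
      _ ≤ C * C * ((K + 1) * (K + 1) * (b n * (b K + 1))) := by gcongr
      _ = D * b n := by rw [hD]; ring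
  have h4 := Nat.le_of_mul_le_mul_right h3 hbn
  omega

/-! ### Multiplicities of words -/

theorem mult_of_mem {α : Type*} {F R : Finset (List α)} {μ : List α → ℕ} {w : List α}
    (hw : w ∈ language (shiftOf F)) : mult F R μ w = ∏ r ∈ R, μ r ^ occ w r := if_pos hw

theorem mult_of_notMem {α : Type*} {F R : Finset (List α)} {μ : List α → ℕ} {w : List α}
    (hw : w ∉ language (shiftOf F)) : mult F R μ w = 0 := if_neg hw

theorem mult_pos {α : Type*} {F R : Finset (List α)} {μ : List α → ℕ}
    (hμ : ∀ r ∈ R, 2 ≤ μ r) {w : List α} (hw : w ∈ language (shiftOf F)) :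
    0 < mult F R μ w := by
  rw [mult_of_mem hw]
  exact Finset.prod_pos fun r hr => Nat.pow_pos (by have := hμ r hr; omega)

open Classical in
theorem occ_cons {α : Type*} (a : α) (w r : List α) :
    occ (a :: w) r = (if r <+: a :: w then 1 else 0) + occ w r := by
  have hfin : {i : ℕ | i < w.length ∧ r <+: w.drop i}.Finite :=
    (Set.finite_lt_nat w.length).subset fun _ h => h.1
  have hinj : Function.Injective Nat.succ := Nat.succ_injective
  have hcard : (Nat.succ '' {i : ℕ | i < w.length ∧ r <+: w.drop i}).ncard = occ w r :=
    Set.ncard_image_of_injective _ hinj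
  have h0 : 0 ∉ Nat.succ '' {i : ℕ | i < w.length ∧ r <+: w.drop i} := by
    rintro ⟨i, _, hi⟩
    omega
  unfold occ at hcard ⊢
  split_ifs with h
  · rw [add_comm, ← hcard, ← Set.ncard_insert_of_notMem h0 (hfin.image _)]
    congr 1
    ext i
    cases i <;> simp [h]
  · rw [zero_add, ← hcard]
    congr 1
    ext i
    cases i <;> simp [h]

/-- The factor by which the first symbol changes the multiplicity of an allowed word depends
only on the beginning of this word. -/
theorem mult_cons {α : Type*} {F R : Finset (List α)} {μ : List α → ℕ}
    (hμ : ∀ r ∈ R, 2 ≤ μ r) {p : ℕ} (hp : 2 ≤ p) (hR : ∀ r ∈ R, r.length ≤ p) {a : α}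
    {w : List α} (hw : a :: w ∈ language (shiftOf F)) (hl : p ≤ w.length + 1) :
    mult F R μ (a :: w) = kNum F R μ ((a :: w).take p) * mult F R μ w := by
  classical
  obtain ⟨q, rfl⟩ : ∃ q, p = q + 2 := ⟨p - 2, by omega⟩
  have hw0 : w ≠ [] := List.ne_nil_of_length_pos (by omega)
  have hwL : w ∈ language (shiftOf F) :=
    mem_language_of_infix hw hw0 (List.suffix_cons a w).isInfix
  have ht0 : w.take (q + 1) ≠ [] := by simp [hw0]
  have htL : w.take (q + 1) ∈ language (shiftOf F) :=
    mem_language_of_infix hwL ht0 (List.take_prefix _ _).isInfix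
  have hvL : a :: w.take (q + 1) ∈ language (shiftOf F) :=
    mem_language_of_infix hw (by simp) (List.take_prefix (q + 2) (a :: w)).isInfix
  have hcons : ∀ y : List α, y ∈ language (shiftOf F) → a :: y ∈ language (shiftOf F) →
      mult F R μ (a :: y) =
        (∏ r ∈ R, μ r ^ (if r <+: a :: y then 1 else 0)) * mult F R μ y := by
    intro y hy hay
    rw [mult_of_mem hay, mult_of_mem hy, ← Finset.prod_mul_distrib]
    refine Finset.prod_congr rfl fun r _ => ?_
    rw [occ_cons, pow_add]
  rw [hcons w hwL hw, List.take_succ_cons, kNum, List.tail_cons, hcons _ htL hvL,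
    Nat.mul_div_cancel _ (mult_pos hμ htL)]
  congr 1
  refine Finset.prod_congr rfl fun r hr => ?_
  -- The new factor only records which `r` begin at the new letter, and these have length at most
  -- `p`.
  have : r <+: a :: w ↔ r <+: a :: w.take (q + 1) := by
    rw [← List.take_succ_cons, List.prefix_take_iff]
    exact ⟨fun h => ⟨h, hR r hr⟩, fun h => h.1⟩
  simp only [this]

theorem kNum_pos {α : Type*} {F R : Finset (List α)} {μ : List α → ℕ}
    (hμ : ∀ r ∈ R, 2 ≤ μ r) {v : List α} (hv : v ∈ language (shiftOf F)) (ht : v.tail ≠ []) :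
    0 < kNum F R μ v := by
  have htL := mem_language_of_infix hv ht (List.tail_suffix v).isInfix
  exact Nat.div_pos (Nat.le_of_dvd (mult_pos hμ hv) (mult_tail_dvd F R μ v ht)) (mult_pos hμ htL)

/-! ### Block sequences -/

theorem blocks_cons {α : Type*} {p : ℕ} {a : α} {w : List α} (h : p ≤ w.length + 1) :
    blocks p (a :: w) = (a :: w).take p :: blocks p w := by
  unfold blocks
  rw [List.length_cons, show w.length + 1 + 1 - p = (w.length + 1 - p) + 1 by omega,
    List.range_succ_eq_map]
  simp [Function.comp_def]

theorem length_blocks {α : Type*} (p : ℕ) (w : List α) :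
    (blocks p w).length = w.length + 1 - p := by simp [blocks]

/-- Each block gives its first letter and the last block gives the rest. Words shorter than `p` have
no blocks, hence the length hypothesis. -/
theorem eq_of_blocks_eq {α : Type*} {p : ℕ} (hp : 0 < p) : ∀ {w v : List α}, p ≤ w.length →
    w.length = v.length → blocks p w = blocks p v → w = v
  | [], _, h, _, _ => by simp at h; omega
  | _ :: _, [], _, h, _ => by simp at h
  | a :: w, b :: v, hl, hwv, h => by
    simp only [List.length_cons, Nat.add_right_cancel_iff] at hl hwv
    rw [blocks_cons hl, blocks_cons (by omega), List.cons.injEq] at h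
    rcases Nat.lt_or_ge w.length p with hlt | hge
    · have h1 := h.1
      rwa [List.take_of_length_le (by simp; omega), List.take_of_length_le (by simp; omega)] at h1
    · obtain ⟨q, rfl⟩ : ∃ q, p = q + 1 := ⟨p - 1, by omega⟩
      have h1 := h.1
      simp only [List.take_succ_cons, List.cons.injEq] at h1
      rw [h1.1, eq_of_blocks_eq hp hge hwv h.2]

/-! ### Edge paths over a word -/

/-- The word of length `p` that an edge of the multigraph of `A` stands for. -/
def edgeLabel {α : Type*} {F R : Finset (List α)} {μ : List α → ℕ}
    (e : Edge (adjMatrix F R μ)) : List α := star e.src.1 e.tgt.1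

theorem star_take {α : Type*} {a : α} {w : List α} {q : ℕ} (h : q + 1 ≤ w.length) :
    star ((a :: w).take (q + 1)) (w.take (q + 1)) = (a :: w).take (q + 2) := by
  unfold star
  have h1 : ((a :: w).take (q + 1)).length = q + 1 := by simp; omega
  rw [h1, Nat.add_sub_cancel, List.drop_take, Nat.add_sub_cancel_left,
    ← List.drop_succ_cons (a := a) (l := w), ← List.take_add]

theorem starDefined_take {α : Type*} {a : α} {w : List α} {q : ℕ} (h : q + 1 ≤ w.length) :
    StarDefined ((a :: w).take (q + 1)) (w.take (q + 1)) := by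
  unfold StarDefined
  rw [List.take_succ_cons, List.tail_cons, List.dropLast_eq_take, List.length_take,
    min_eq_left h, Nat.add_sub_cancel, List.take_take, min_eq_left (Nat.le_succ q)]

/-- The allowed word of length `p - 1` at the beginning of a longer one. -/
def startVertex {α : Type*} (F R : Finset (List α)) (w : List α) (hp : 2 ≤ maxLen F R)
    (hw : w ∈ language (shiftOf F)) (hl : maxLen F R - 1 ≤ w.length) :
    AllowedWord F (maxLen F R - 1) :=
  ⟨w.take (maxLen F R - 1), mem_language_of_infix hw
    (List.ne_nil_of_length_pos (by rw [List.length_take]; omega)) (List.take_prefix _ _).isInfix,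
    by rw [List.length_take]; omega⟩

/-- This links the matrix to the recursion in `mult_cons`: the number of edges between the initial
vertices of `a :: w` and `w` is exactly the factor gained by prepending `a`. -/
theorem adjMatrix_startVertex {α : Type*} {F R : Finset (List α)} {μ : List α → ℕ}
    (hp : 2 ≤ maxLen F R) {a : α} {w : List α} (hw : a :: w ∈ language (shiftOf F))
    (hl : maxLen F R - 1 ≤ w.length) (hwL : w ∈ language (shiftOf F)) :
    star (startVertex F R (a :: w) hp hw (by simp; omega)).1 (startVertex F R w hp hwL hl).1 =
        (a :: w).take (maxLen F R) ∧
      adjMatrix F R μ (startVertex F R (a :: w) hp hw (by simp; omega))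
        (startVertex F R w hp hwL hl) = kNum F R μ ((a :: w).take (maxLen F R)) := by
  have hstar : star (startVertex F R (a :: w) hp hw (by simp; omega)).1
      (startVertex F R w hp hwL hl).1 = (a :: w).take (maxLen F R) := by
    have := star_take (a := a) (w := w) (q := maxLen F R - 2) (by omega)
    rw [show maxLen F R - 2 + 1 = maxLen F R - 1 by omega, Nat.sub_add_cancel hp] at this
    exact this
  have hdef := starDefined_take (a := a) (w := w) (q := maxLen F R - 2) (by omega)
  rw [show maxLen F R - 2 + 1 = maxLen F R - 1 by omega] at hdef
  refine ⟨hstar, ?_⟩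
  unfold adjMatrix
  rw [hstar, if_pos]
  refine ⟨hdef, mem_language_of_infix hw ?_ (List.take_prefix _ _).isInfix⟩
  exact List.ne_nil_of_length_pos (by rw [List.length_take, List.length_cons]; omega)

/-- The edge words that begin at the first vertex of `w` and read as `w`. -/
def edgeWords {α : Type*} (F R : Finset (List α)) (μ : List α → ℕ) (w : List α) :
    Set (List (Edge (adjMatrix F R μ))) :=
  {u | u.map edgeLabel = blocks (maxLen F R) w ∧ ∃ y ∈ edgeShift (adjMatrix F R μ),
    (y 0).src.1 = w.take (maxLen F R - 1) ∧ ∀ (j : ℕ) (hj : j < u.length), y j = u[j]}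

instance {α : Type*} [Finite α] (F : Finset (List α)) (n : ℕ) : Finite (AllowedWord F n) :=
  ((List.finite_length_eq α n).subset fun _ h => h.2).to_subtype

instance {V : Type*} [Finite V] (A : Matrix V V ℕ) : Finite (Edge A) := by
  have h (x : V) : Finite (Σ y : V, Fin (A x y)) := inferInstance
  refine Finite.of_injective
    (fun e => (⟨e.src, e.tgt, e.idx⟩ : Σ x : V, Σ y : V, Fin (A x y))) ?_
  rintro ⟨x, y, i⟩ ⟨x', y', i'⟩ h
  simp only [Sigma.mk.injEq] at h
  obtain ⟨rfl, h⟩ := h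
  simpa using h

theorem finite_edgeWords {α : Type*} [Finite α] (F R : Finset (List α)) (μ : List α → ℕ)
    (w : List α) : (edgeWords F R μ w).Finite := by
  refine (List.finite_length_eq _ (w.length + 1 - maxLen F R)).subset fun u hu => ?_
  have := congrArg List.length hu.1
  rwa [List.length_map, length_blocks] at this

/-- An infinite path of edges begins at every vertex. -/
theorem exists_edgeShift_start {α : Type*} {F R : Finset (List α)} {μ : List α → ℕ}
    (hμ : ∀ r ∈ R, 2 ≤ μ r) (hp : 2 ≤ maxLen F R) {w : List α}
    (hw : w ∈ language (shiftOf F)) (hl : w.length = maxLen F R - 1) :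
    ∃ y ∈ edgeShift (adjMatrix F R μ), (y 0).src.1 = w := by
  obtain ⟨x, hx, hxw⟩ := exists_start_of_mem_language hw
  have hL : ∀ i n : ℕ, List.ofFn (fun k : Fin (n + 1) => x (i + k)) ∈ language (shiftOf F) :=
    fun i n => ⟨by simp, x, hx, i, by simp [-List.ofFn_succ]⟩
  obtain ⟨q, hq⟩ : ∃ q, maxLen F R = q + 2 := ⟨maxLen F R - 2, by omega⟩
  have hcons : ∀ i, List.ofFn (fun k : Fin (q + 1 + 1) => x (i + k)) =
      x i :: List.ofFn (fun k : Fin (q + 1) => x (i + 1 + k)) := by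
    intro i
    rw [List.ofFn_succ]
    simp [add_assoc, add_comm 1]
  have hcL : ∀ i, x i :: List.ofFn (fun k : Fin (q + 1) => x (i + 1 + k)) ∈
      language (shiftOf F) := fun i => hcons i ▸ hL i (q + 1)
  -- The path runs through the successive windows of length `p - 1` of `x`; consecutive windows are
  -- joined by an edge because `k` is positive on allowed words.
  let V : ℕ → AllowedWord F (maxLen F R - 1) := fun i =>
    ⟨List.ofFn (fun k : Fin (q + 1) => x (i + k)), hL i q, by simp; omega⟩
  have hpos : ∀ i, 0 < adjMatrix F R μ (V i) (V (i + 1)) := by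
    intro i
    have h := (adjMatrix_startVertex (R := R) (μ := μ) hp (hcL i) (by simp; omega)
      (hL (i + 1) q)).2
    have e1 : startVertex F R _ hp (hcL i) (by simp; omega) = V i := by
      refine Subtype.ext ?_
      simp only [startVertex, V, ← hcons, hq, Nat.add_succ_sub_one]
      refine List.ext_getElem (by simp) fun j h1 h2 => by simp [-List.ofFn_succ]
    have e2 : startVertex F R _ hp (hL (i + 1) q) (by simp; omega) = V (i + 1) := by
      refine Subtype.ext ?_
      simp only [startVertex, V]
      exact List.take_of_length_le (by simp; omega)
    rw [e1, e2] at h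
    rw [h, List.take_of_length_le (by simp; omega)]
    exact kNum_pos hμ (hcL i) (by simp)
  refine ⟨fun i => ⟨V i, V (i + 1), ⟨0, hpos i⟩⟩, fun i => rfl, ?_⟩
  refine List.ext_getElem (by simp [V]; omega) fun j h1 h2 => ?_
  simp [-List.ofFn_succ, V, hxw j h2]

/-- There are at least `m(w) / m(v)` edge words that read as `w`, where `v` is the suffix of
length `p - 1` of `w`. -/
theorem mult_le_mul_ncard_edgeWords {α : Type*} [Finite α] {F R : Finset (List α)}
    {μ : List α → ℕ} (hμ : ∀ r ∈ R, 2 ≤ μ r) (hp : 2 ≤ maxLen F R) {M : ℕ}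
    (hM : ∀ v : List α, v.length = maxLen F R - 1 → mult F R μ v ≤ M) :
    ∀ w ∈ language (shiftOf F), maxLen F R - 1 ≤ w.length →
      mult F R μ w ≤ M * (edgeWords F R μ w).ncard := by
  intro w
  induction w with
  | nil => exact fun h => absurd rfl h.1
  | cons a w ih =>
    intro hw hl
    rw [List.length_cons] at hl
    rcases Nat.lt_or_ge w.length (maxLen F R - 1) with hlt | hge
    · have hl' : (a :: w).length = maxLen F R - 1 := by rw [List.length_cons]; omega
      have hb : blocks (maxLen F R) (a :: w) = [] :=
        List.eq_nil_of_length_eq_zero (by rw [length_blocks]; omega)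
      obtain ⟨y, hy, hy0⟩ := exists_edgeShift_start hμ hp hw hl'
      -- A word of length `p - 1` has no blocks and is read by the empty path; the constant `M`
      -- absorbs its multiplicity.
      have hmem : [] ∈ edgeWords F R μ (a :: w) := by
        refine ⟨hb.symm, y, hy, ?_, fun j hj => absurd hj (by simp)⟩
        rw [hy0, List.take_of_length_le hl'.le]
      have : 0 < (edgeWords F R μ (a :: w)).ncard :=
        (Set.ncard_pos (finite_edgeWords F R μ _)).2 ⟨_, hmem⟩
      exact (hM _ hl').trans (Nat.le_mul_of_pos_right _ this)
    · have hwL : w ∈ language (shiftOf F) := mem_language_of_infix hw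
        (List.ne_nil_of_length_pos (by omega)) (List.suffix_cons a w).isInfix
      have hR : ∀ r ∈ R, r.length ≤ maxLen F R := fun r hr =>
        (Finset.le_sup (f := List.length) hr).trans (le_max_right _ _)
      rw [mult_cons hμ hp hR hw (by omega)]
      obtain ⟨hstar, hadj⟩ := adjMatrix_startVertex (R := R) (μ := μ) hp hw hge hwL
      rw [← hadj]
      set X := startVertex F R (a :: w) hp hw (by simp; omega)
      set Y := startVertex F R w hp hwL hge
      refine (Nat.mul_le_mul_left _ (ih hwL hge)).trans ?_
      rw [mul_left_comm]
      refine Nat.mul_le_mul_left _ ?_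
      rw [← Nat.card_fin (adjMatrix F R μ X Y), ← Set.ncard_univ, ← Set.ncard_prod]
      -- Each path over `w` extends to the left by any of the `A X Y` edges. The prescribed initial
      -- vertex in `edgeWords` is what makes the new edge composable.
      refine Set.ncard_le_ncard_of_injOn
        (fun q => (⟨X, Y, q.1⟩ : Edge (adjMatrix F R μ)) :: q.2) ?_ ?_ (finite_edgeWords F R μ _)
      · rintro ⟨i, u⟩ ⟨-, hu, y, hy, hy0, hyu⟩
        refine ⟨?_, prepend [⟨X, Y, i⟩] y, ?_, rfl, ?_⟩
        · rw [blocks_cons (by omega), List.map_cons, hu, ← hstar]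
          rfl
        · rintro (_ | j)
          · exact Subtype.ext hy0.symm
          · exact hy j
        · rintro (_ | j) hj
          · rfl
          · exact hyu j (by simpa using hj)
      · rintro ⟨i, u⟩ _ ⟨i', u'⟩ _ h
        simpa using h

/-- Paths over different words of the same length are different, since blocks determine the word;
the bounds for single words therefore add up. -/
theorem sum_mult_le_wordCount {α : Type*} [Finite α] {F R : Finset (List α)} {μ : List α → ℕ}
    (hμ : ∀ r ∈ R, 2 ≤ μ r) (hp : 2 ≤ maxLen F R) :
    ∃ M : ℕ, ∀ (j : ℕ) (W : Finset (List α)), 0 < j →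
      (∀ w ∈ W, w.length + 1 = j + maxLen F R) →
      ∑ w ∈ W, mult F R μ w ≤ M * wordCount (language (edgeShift (adjMatrix F R μ))) j := by
  classical
  obtain ⟨M, hM⟩ := ((List.finite_length_eq α (maxLen F R - 1)).image (mult F R μ)).bddAbove
  refine ⟨M, fun j W hj hW => ?_⟩
  have h1 : ∀ w ∈ W, mult F R μ w ≤ M * (finite_edgeWords F R μ w).toFinset.card := by
    intro w hwW
    rw [← Set.ncard_eq_toFinset_card _ (finite_edgeWords F R μ w)]
    by_cases hw : w ∈ language (shiftOf F)
    · have := hW w hwW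
      exact mult_le_mul_ncard_edgeWords hμ hp (fun v hv => hM ⟨v, hv, rfl⟩) w hw (by omega)
    · rw [mult_of_notMem hw]
      exact Nat.zero_le _
  refine (Finset.sum_le_sum h1).trans ?_
  rw [← Finset.mul_sum]
  refine Nat.mul_le_mul_left _ ?_
  rw [← Finset.card_biUnion, wordCount,
    Set.ncard_eq_toFinset_card _ (finite_words (language (edgeShift (adjMatrix F R μ))) j)]
  · refine Finset.card_le_card fun u hu => ?_
    simp only [Finset.mem_biUnion, Set.Finite.mem_toFinset] at hu
    obtain ⟨w, hwW, hu, y, hy, -, hyu⟩ := hu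
    have hl := congrArg List.length hu
    rw [List.length_map, length_blocks] at hl
    have := hW w hwW
    have hlj : u.length = j := by omega
    rw [Set.Finite.mem_toFinset]
    exact ⟨⟨List.ne_nil_of_length_pos (by omega), y, hy, 0, by simpa using hyu⟩, hlj⟩
  · intro w hw v hv hne
    rw [Function.onFun, Finset.disjoint_left]
    intro u hu hu'
    rw [Set.Finite.mem_toFinset] at hu hu'
    have hlw := hW w hw
    have hlv := hW v hv
    exact hne (eq_of_blocks_eq (by omega) (by omega) (by omega) (hu.1.symm.trans hu'.1))

/-! ### Comparison and conclusion -/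

/-- A language contained in the generalized language grows at most as fast as that of the edge
shift. -/
theorem wordCount_le_of_langSubsetGen {α β : Type*} [Finite α] [Finite β]
    {F R : Finset (List α)} {μ : List α → ℕ} (hμ : ∀ r ∈ R, 2 ≤ μ r) (hp : 2 ≤ maxLen F R)
    {L : Set (List β)} (hL : LangSubsetGen (maxLen F R) L (genLang F R μ (maxLen F R))) :
    ∃ M : ℕ, ∀ j, 0 < j →
      wordCount L j ≤ M * wordCount (language (edgeShift (adjMatrix F R μ))) j := by
  classical
  obtain ⟨π, hπ, hle⟩ := hL
  obtain ⟨M, hM⟩ := sum_mult_le_wordCount hμ hp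
  refine ⟨M, fun j hj => ?_⟩
  let W : Finset (List α) := (List.finite_length_eq α (j + maxLen F R - 1)).toFinset
  have hW : ∀ w, w ∈ W ↔ w.length = j + maxLen F R - 1 := fun w => by simp [W]
  refine le_trans ?_ (hM j W hj fun w hw => by rw [hW] at hw; omega)
  -- A word with `j` symbols reads as the `j` blocks of a word of length `j + p - 1`, so the fibres
  -- over such words exhaust it.
  have hcover : {u ∈ L | u.length = j} ⊆
      ⋃ w ∈ W, {u ∈ L | u.map π = blocks (maxLen F R) w} := by
    rintro u ⟨hu, hl⟩
    obtain ⟨w, hw1, hw2⟩ := hπ u hu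
    have := congrArg List.length hw2
    rw [List.length_map, length_blocks] at this
    simp only [Set.mem_iUnion]
    exact ⟨w, (hW w).2 (by omega), hu, hw2⟩
  have hcount : ∀ w ∈ W, {u ∈ L | u.map π = blocks (maxLen F R) w}.encard ≤ mult F R μ w := by
    intro w hw
    have h := hle w
    rw [hW] at hw
    rwa [genLang, if_pos (by omega)] at h
  have hfin : ∀ w ∈ W, {u ∈ L | u.map π = blocks (maxLen F R) w}.Finite := fun w hw =>
    Set.finite_of_encard_le_coe (hcount w hw)
  have hUfin : (⋃ w ∈ W, {u ∈ L | u.map π = blocks (maxLen F R) w}).Finite :=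
    W.finite_toSet.biUnion hfin
  refine (Set.ncard_le_ncard hcover hUfin).trans ((Finset.set_ncard_biUnion_le _ _).trans ?_)
  refine Finset.sum_le_sum fun w hw => ?_
  have h := hcount w hw
  rw [← (hfin w hw).cast_ncard_eq] at h
  exact_mod_cast h

theorem wordCount_image_map {β γ : Type*} (φ : β ↪ γ) (L : Set (List β)) (n : ℕ) :
    wordCount (List.map φ '' L) n = wordCount L n := by
  unfold wordCount
  rw [← Set.ncard_image_of_injective _ (List.map_injective_iff.2 φ.injective)]
  congr 1
  ext u
  constructor
  · rintro ⟨⟨v, hv, rfl⟩, hl⟩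
    exact ⟨v, ⟨hv, by simpa using hl⟩, rfl⟩
  · rintro ⟨v, ⟨hv, hl⟩, rfl⟩
    exact ⟨⟨v, hv, rfl⟩, by simpa using hl⟩

end GenLang

theorem mainTheorem3 {α : Type*} [Finite α] (F R : Finset (List α)) (μ : List α → ℕ)
    (hF_len : ∀ u ∈ F, 2 ≤ u.length) (hF_red : GenLang.IsReduced F)
    (h_symb : ∀ a : α, [a] ∈ GenLang.language (GenLang.shiftOf F))
    (h_irr : GenLang.IsIrreducibleShift (GenLang.shiftOf F))
    (hR_allowed : ∀ r ∈ R, r ∈ GenLang.language (GenLang.shiftOf F))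
    (hR_red : GenLang.IsReduced R) (hR_mult : ∀ r ∈ R, 2 ≤ μ r)
    (hp : 2 ≤ GenLang.maxLen F R) :
    ∀ (β : Type*) [Finite β] (S : Set (ℕ → β)),
      GenLang.IsSFT S → GenLang.IsIrreducibleShift S →
      GenLang.LangSubsetGen (GenLang.maxLen F R) (GenLang.language S)
        (GenLang.genLang F R μ (GenLang.maxLen F R)) →
      ¬ (GenLang.LangSSubset (GenLang.language (GenLang.edgeShift (GenLang.adjMatrix F R μ)))
            (GenLang.language S) ∧
          GenLang.LangSSubsetGen (GenLang.maxLen F R) (GenLang.language S)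
            (GenLang.genLang F R μ (GenLang.maxLen F R))) := by
  intro β _ S hS hSirr hSL ⟨⟨φ, hφ⟩, _⟩
  obtain ⟨M, hM⟩ := GenLang.wordCount_le_of_langSubsetGen hR_mult hp hSL
  -- The relabelled language of `Σ_A` is the factor-closed proper sublanguage; injective relabelling
  -- preserves its word counts.
  refine GenLang.not_wordCount_le_mul hS hSirr hφ ?_ M fun n hn => ?_
  · rintro _ ⟨u, hu, rfl⟩ v hv hvu
    obtain ⟨v, h, rfl⟩ := List.infix_map_iff.1 hvu
    exact ⟨v, GenLang.mem_language_of_infix hu (by simpa using hv) h, rfl⟩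
  · rw [GenLang.wordCount_image_map]
    exact hM n hn
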